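/- Let $A$ be a Hopf algebra over $\mathbb{C}$ with comultiplication $\Delta$ and counit $\varepsilon$, and let $B\subseteq A$ be a left coideal subalgebra, i.e. a unital subalgebra with $\Delta(B)\subseteq A\otimes B$. Write $\Delta(a)=a_{(1)}\otimes a_{(2)}$, $b^+=b-\varepsilon(b)1$, $B^+=\{b^+\mid b\in B\}=\{b\in B\mid\varepsilon(b)=0\}$, $\overline{A}=A/(B^+A)$ (where $B^+A$ is the linear span of all products), and let $\overline{\Delta}:A\to\overline{A}\otimes A$, $\overline{\Delta}(a)=\overline{a_{(1)}}\otimes a_{(2)}$. A derivation of $B$ is a $\mathbb{C}$-linear map $\delta$ from $B$ into a $B$-bimodule with $\delta(ab)=a\,\delta b+\delta a\,b$ for all $a,b\in B$; put $\Gamma(\delta)=\mathrm{Lin}_{\mathbb{C}}\{a\,\delta b\mid a,b\in B\}$. Write $\delta\le\delta'$ if the linear map $\Gamma(\delta')\to\Gamma(\delta)$, $a\,\delta' b\mapsto a\,\delta b$, is well defined; derivations with $\delta\le\delta'$ and $\delta'\le\delta$ are considered identical. A derivation $\delta$ is equivariant if the linear map $\Gamma(\delta)\to A\otimes\Gamma(\delta)$,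 $a\,\delta b\mapsto a_{(1)}b_{(1)}\otimes a_{(2)}\,\delta b_{(2)}$, is well defined. For a right ideal $R$ of $B^+$ with canonical projection $p:B^+\to B^+/R$, let $\delta_R:B\to A\otimes(B^+/R)$ be the derivation $\delta_R b=b_{(1)}\otimes p(b_{(2)}^+)$, where $A\otimes(B^+/R)$ is a $B$-bimodule by $b\,(a\otimes p(x))\,c=b\,a\,c_{(1)}\otimes p(x\,c_{(2)})$; thus $a\,\delta_R b=a\,b_{(1)}\otimes p(b_{(2)}^+)$. For a derivation $\delta$ of $B$, let $R_\delta=\{\sum_i\varepsilon(a_i)\,b_i^+\mid\sum_i a_i\,\delta b_i=0\}$, which is a right ideal of $B^+$. Theorem. Suppose that $A$ is faithfully flat as a right $B$-module, i.e. the functor $M\mapsto A\otimes_B M$ from left $B$-modules to complex vector spaces preserves and reflects exact sequences. Then $R\mapsto\delta_R$ and $\delta\mapsto R_\delta$ are mutually inverse bijections between the set of right ideals $R$ of $B^+$ with $\overline{\Delta}(R)\subseteq\overline{A}\otimes R$ and the set of equivariant derivations of $B$ (up to the above identification). -/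

import Mathlib

open scoped TensorProduct

universe u

noncomputable section

namespace QHS

section Coideal

variable {A : Type u} [Ring A] [HopfAlgebra ℂ A]

/-- The subalgebra `B` of `A` is a left coideal: `Δ(B) ⊆ A ⊗ B`, where `A ⊗ B` is viewed as a
subspace of `A ⊗ A`. -/
def IsLeftCoideal (B : Subalgebra ℂ A) : Prop :=
  ∀ b ∈ B, Coalgebra.comul (R := ℂ) b ∈ LinearMap.range (B.val.toLinearMap.lTensor A)

variable (B : Subalgebra ℂ A)

theorem lTensor_val_injective :
    Function.Injective (B.val.toLinearMap.lTensor A) :=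
  Module.Flat.lTensor_preserves_injective_linearMap _ Subtype.val_injective

variable {B}

/-- The comultiplication of `A`, restricted to a linear map `B → A ⊗ B`. -/
def coactLin (hB : IsLeftCoideal B) : B →ₗ[ℂ] A ⊗[ℂ] B :=
  (LinearEquiv.ofInjective _ (lTensor_val_injective B)).symm.toLinearMap ∘ₗ
    (Coalgebra.comul ∘ₗ B.val.toLinearMap).codRestrict
      (LinearMap.range (B.val.toLinearMap.lTensor A)) (fun b => hB b.1 b.2)

theorem lTensor_coactLin (hB : IsLeftCoideal B) (b : B) :
    B.val.toLinearMap.lTensor A (coactLin hB b) = Coalgebra.comul (R := ℂ) (b : A) := by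
  have h := LinearEquiv.apply_symm_apply (LinearEquiv.ofInjective _ (lTensor_val_injective B))
    ((Coalgebra.comul ∘ₗ B.val.toLinearMap).codRestrict
      (LinearMap.range (B.val.toLinearMap.lTensor A)) (fun b => hB b.1 b.2) b)
  exact congrArg Subtype.val h

theorem lTensor_val_eq_map (x : A ⊗[ℂ] B) :
    B.val.toLinearMap.lTensor A x = Algebra.TensorProduct.map (AlgHom.id ℂ A) B.val x := rfl

theorem coactLin_one (hB : IsLeftCoideal B) : coactLin hB 1 = 1 := by
  apply lTensor_val_injective B
  rw [lTensor_coactLin, lTensor_val_eq_map, map_one]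
  exact Bialgebra.comul_one

theorem coactLin_mul (hB : IsLeftCoideal B) (b c : B) :
    coactLin hB (b * c) = coactLin hB b * coactLin hB c := by
  apply lTensor_val_injective B
  rw [lTensor_coactLin, lTensor_val_eq_map, map_mul, ← lTensor_val_eq_map, ← lTensor_val_eq_map,
    lTensor_coactLin, lTensor_coactLin]
  exact Bialgebra.comul_mul _ _

variable (B)

/-- The restriction of the counit to `B`. -/
def counitB : B →ₗ[ℂ] ℂ := Coalgebra.counit ∘ₗ B.val.toLinearMap

theorem counitB_one : counitB B 1 = 1 := Bialgebra.counit_one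

theorem counitB_mul (b c : B) : counitB B (b * c) = counitB B b * counitB B c :=
  Bialgebra.counit_mul _ _

variable {B}

theorem counit_coactLin (hB : IsLeftCoideal B) (b : B) :
    TensorProduct.rid ℂ A ((counitB B).lTensor A (coactLin hB b)) = (b : A) := by
  have h := Coalgebra.lTensor_counit_comul (R := ℂ) (b : A)
  rw [← lTensor_coactLin hB b, ← LinearMap.comp_apply, ← LinearMap.lTensor_comp] at h
  have h2 : (counitB B).lTensor A (coactLin hB b) = (b : A) ⊗ₜ[ℂ] (1 : ℂ) := h
  rw [h2]; simp

end Coideal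

section Augmentation

variable {A : Type u} [Ring A] [HopfAlgebra ℂ A] (B : Subalgebra ℂ A)

/-- `B⁺ = {b ∈ B | ε(b) = 0}`, which is also the set of all `b⁺ = b - ε(b) 1` with `b ∈ B`. -/
def Bplus : Submodule ℂ B := LinearMap.ker (counitB B)

/-- The map `b ↦ b⁺ = b - ε(b) 1`. -/
def plus : B →ₗ[ℂ] Bplus B :=
  (LinearMap.id - (counitB B).smulRight (1 : B)).codRestrict (Bplus B) (fun b => by
    simp [Bplus, counitB_one])

theorem coe_plus (b : B) : (plus B b : B) = b - counitB B b • (1 : B) := rfl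

theorem plus_surjective : Function.Surjective (plus B) := by
  rintro ⟨b, hb⟩
  refine ⟨b, Subtype.ext ?_⟩
  rw [coe_plus, show counitB B b = 0 from hb]
  simp

variable {B} in
theorem mul_mem_Bplus {x : B} (hx : x ∈ Bplus B) (c : B) : x * c ∈ Bplus B := by
  have hx' : counitB B x = 0 := hx
  change counitB B (x * c) = 0
  rw [counitB_mul, hx', zero_mul]

/-- Right multiplication by `c ∈ B` on `B⁺`. -/
def rmul (c : B) : Bplus B →ₗ[ℂ] Bplus B :=
  ((LinearMap.mulRight ℂ c) ∘ₗ (Bplus B).subtype).codRestrict (Bplus B)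
    (fun x => mul_mem_Bplus x.2 c)

theorem coe_rmul (c : B) (x : Bplus B) : (rmul B c x : B) = (x : B) * c := rfl

/-- A right ideal of the (nonunital) algebra `B⁺`. -/
@[ext]
structure RightIdeal where
  /-- The underlying linear subspace of `B⁺`. -/
  carrier : Submodule ℂ (Bplus B)
  mul_mem : ∀ r ∈ carrier, ∀ c : Bplus B, rmul B (c : B) r ∈ carrier

variable {B}

theorem RightIdeal.rmul_mem (R : RightIdeal B) (c : B) {r : Bplus B} (hr : r ∈ R.carrier) :
    rmul B c r ∈ R.carrier := by
  have h : rmul B c r = rmul B (plus B c : B) r + counitB B c • r := by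
    apply Subtype.ext
    simp [coe_rmul, coe_plus, mul_sub]
  rw [h]
  exact R.carrier.add_mem (R.mul_mem r hr _) (R.carrier.smul_mem _ hr)

/-- The linear subspace `B⁺A` of `A`. -/
def BplusA (B : Subalgebra ℂ A) : Submodule ℂ A :=
  Submodule.span ℂ {x | ∃ b ∈ Bplus B, ∃ a : A, x = (b : A) * a}

/-- The map `Δ̄ : A → Ā ⊗ A`, `Δ̄ = (¯ ⊗ id) ∘ Δ`, where `Ā = A / B⁺A`. -/
def comulBar (B : Subalgebra ℂ A) : A →ₗ[ℂ] (A ⧸ BplusA B) ⊗[ℂ] A :=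
  (BplusA B).mkQ.rTensor A ∘ₗ Coalgebra.comul

/-- The inclusion of a right ideal of `B⁺` into `A`. -/
def RightIdeal.incl (R : RightIdeal B) : R.carrier →ₗ[ℂ] A :=
  B.val.toLinearMap ∘ₗ (Bplus B).subtype ∘ₗ R.carrier.subtype

/-- The condition `Δ̄(R) ⊆ Ā ⊗ R`, where `Ā ⊗ R` is viewed as a subspace of `Ā ⊗ A`. -/
def RightIdeal.IsStable (R : RightIdeal B) : Prop :=
  ∀ r : R.carrier, comulBar B (R.incl r) ∈ LinearMap.range (R.incl.lTensor (A ⧸ BplusA B))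

end Augmentation

section Flat

variable {A : Type u} [Ring A] [Algebra ℂ A] (B : Subalgebra ℂ A)

/-- The subspace of `A ⊗ M` spanned by all `a b ⊗ m - a ⊗ b m` with `b ∈ B`. -/
def balanced (M : Type u) [AddCommGroup M] [Module ℂ M] [Module B M] :
    Submodule ℂ (A ⊗[ℂ] M) :=
  Submodule.span ℂ {x | ∃ (a : A) (b : B) (m : M), x = (a * b) ⊗ₜ[ℂ] m - a ⊗ₜ[ℂ] (b • m)}

/-- The tensor product `A ⊗_B M` of the right `B`-module `A` with the left `B`-module `M`. -/
abbrev TensorB (M : Type u) [AddCommGroup M] [Module ℂ M] [Module B M] : Type u :=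
  (A ⊗[ℂ] M) ⧸ balanced B M

variable {B} in
/-- The map `A ⊗_B f : A ⊗_B M → A ⊗_B N` induced by a `B`-linear map `f : M → N`. -/
def tensorBMap {M N : Type u} [AddCommGroup M] [Module ℂ M] [Module B M] [IsScalarTower ℂ B M]
    [AddCommGroup N] [Module ℂ N] [Module B N] [IsScalarTower ℂ B N] (f : M →ₗ[B] N) :
    TensorB B M →ₗ[ℂ] TensorB B N :=
  (balanced B M).mapQ (balanced B N) ((f.restrictScalars ℂ).lTensor A) (by
    rw [balanced, Submodule.span_le]
    rintro _ ⟨a, b, m, rfl⟩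
    apply Submodule.subset_span
    exact ⟨a, b, f m, by simp⟩)

/-- `A` is faithfully flat as a right `B`-module: the functor `M ↦ A ⊗_B M` from left `B`-modules
to complex vector spaces preserves and reflects exact sequences. -/
def IsFaithfullyFlatRight : Prop :=
  ∀ (M N P : Type u) [AddCommGroup M] [Module ℂ M] [Module B M] [IsScalarTower ℂ B M]
    [AddCommGroup N] [Module ℂ N] [Module B N] [IsScalarTower ℂ B N]
    [AddCommGroup P] [Module ℂ P] [Module B P] [IsScalarTower ℂ B P]
    (f : M →ₗ[B] N) (g : N →ₗ[B] P),
    Function.Exact f g ↔ Function.Exact (tensorBMap f) (tensorBMap g)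

end Flat

section Derivations

open MulOpposite

variable {A : Type u} [Ring A] [HopfAlgebra ℂ A]

/-- A derivation of `B`: a complex-linear map `d` from `B` into some `B`-bimodule, satisfying the
Leibniz rule. Right actions of `B` are written as left actions of the opposite algebra. -/
structure Deriv (B : Subalgebra ℂ A) where
  /-- The bimodule. -/
  M : Type u
  [addCommGroup : AddCommGroup M]
  [module : Module ℂ M]
  [leftModule : Module B M]
  [rightModule : Module Bᵐᵒᵖ M]
  [leftTower : IsScalarTower ℂ B M]
  [rightTower : IsScalarTower ℂ Bᵐᵒᵖ M]
  [bimodule : SMulCommClass B Bᵐᵒᵖ M]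
  /-- The derivation. -/
  d : B →ₗ[ℂ] M
  leibniz : ∀ a b : B, d (a * b) = a • d b + op b • d a

attribute [instance] Deriv.addCommGroup Deriv.module Deriv.leftModule Deriv.rightModule
  Deriv.leftTower Deriv.rightTower Deriv.bimodule

namespace Deriv

variable {B : Subalgebra ℂ A} (δ δ' : Deriv B)

/-- `Γ(δ)`, the complex-linear span of all `a δ b`. -/
def Gamma : Submodule ℂ δ.M := Submodule.span ℂ {x | ∃ a b : B, x = a • δ.d b}

/-- The element `a δ b` of `Γ(δ)`. -/
def form (a b : B) : δ.Gamma := ⟨a • δ.d b, Submodule.subset_span ⟨a, b, rfl⟩⟩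

/-- The linear map `B ⊗ B → Γ(δ)`, `a ⊗ b ↦ a δ b`. -/
def formLin : B ⊗[ℂ] B →ₗ[ℂ] δ.Gamma :=
  TensorProduct.lift (LinearMap.mk₂ ℂ δ.form
    (fun a a' b => Subtype.ext (add_smul a a' (δ.d b)))
    (fun z a b => Subtype.ext (smul_assoc z a (δ.d b)))
    (fun a b b' => Subtype.ext (by simp [form]))
    (fun z a b => Subtype.ext (by
      change a • δ.d (z • b) = z • (a • δ.d b)
      rw [map_smul, ← algebraMap_smul B z (δ.d b), ← algebraMap_smul B z (a • δ.d b), smul_smul,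
        smul_smul, Algebra.commutes])))

theorem formLin_tmul (a b : B) : δ.formLin (a ⊗ₜ[ℂ] b) = δ.form a b := rfl

theorem formLin_surjective : Function.Surjective δ.formLin := by
  rintro ⟨x, hx⟩
  have h : δ.Gamma ≤ (LinearMap.range δ.formLin).map δ.Gamma.subtype := by
    apply Submodule.span_le.2
    rintro _ ⟨a, b, rfl⟩
    exact ⟨δ.form a b, ⟨a ⊗ₜ b, rfl⟩, rfl⟩
  obtain ⟨y, ⟨t, rfl⟩, ht⟩ := h hx
  exact ⟨t, Subtype.ext ht⟩

/-- `δ ≤ δ'` if and only if `Γ(δ') → Γ(δ)`, `a δ' b ↦ a δ b` is a well-defined linear map. -/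
instance : Preorder (Deriv B) where
  le δ δ' := ∃ φ : δ'.Gamma →ₗ[ℂ] δ.Gamma, ∀ a b : B, φ (δ'.form a b) = δ.form a b
  le_refl _ := ⟨LinearMap.id, fun _ _ => rfl⟩
  le_trans _ _ _ := fun ⟨φ, hφ⟩ ⟨ψ, hψ⟩ => ⟨φ ∘ₗ ψ, fun a b => by simp [hφ, hψ]⟩

/-- The linear map `(A ⊗ B) ⊗ (A ⊗ B) → A ⊗ Γ(δ)`, `(x ⊗ a) ⊗ (y ⊗ b) ↦ x y ⊗ a δ b`. -/
def diagForm : (A ⊗[ℂ] B) ⊗[ℂ] (A ⊗[ℂ] B) →ₗ[ℂ] A ⊗[ℂ] δ.Gamma :=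
  TensorProduct.map (LinearMap.mul' ℂ A) δ.formLin ∘ₗ
    (TensorProduct.tensorTensorTensorComm ℂ A B A B).toLinearMap

theorem diagForm_tmul (x y : A) (a b : B) :
    δ.diagForm ((x ⊗ₜ a) ⊗ₜ (y ⊗ₜ b)) = (x * y) ⊗ₜ[ℂ] δ.form a b := rfl

/-- `δ` is equivariant if and only if the linear map
`Γ(δ) → A ⊗ Γ(δ)`, `a δ b ↦ a₍₁₎ b₍₁₎ ⊗ a₍₂₎ δ b₍₂₎` is well-defined. -/
def IsEquivariant (hB : IsLeftCoideal B) : Prop :=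
  ∃ Φ : δ.Gamma →ₗ[ℂ] A ⊗[ℂ] δ.Gamma,
    ∀ a b : B, Φ (δ.form a b) = δ.diagForm (coactLin hB a ⊗ₜ coactLin hB b)

variable {δ δ'} in
theorem IsEquivariant.congr {hB : IsLeftCoideal B} (h : δ.IsEquivariant hB) (h₁ : δ ≤ δ')
    (h₂ : δ' ≤ δ) : δ'.IsEquivariant hB := by
  obtain ⟨Φ, hΦ⟩ := h
  obtain ⟨φ, hφ⟩ := h₁
  obtain ⟨ψ, hψ⟩ := h₂
  refine ⟨ψ.lTensor A ∘ₗ Φ ∘ₗ φ, fun a b => ?_⟩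
  have key : ψ.lTensor A ∘ₗ δ.diagForm = δ'.diagForm := by
    ext x a y b
    simp [diagForm_tmul, hψ]
  rw [LinearMap.comp_apply, LinearMap.comp_apply, hφ, hΦ, ← LinearMap.comp_apply, key]

/-- The linear map `B ⊗ B → B⁺`, `a ⊗ b ↦ ε(a) b⁺`. -/
def counitPlus (B : Subalgebra ℂ A) : B ⊗[ℂ] B →ₗ[ℂ] Bplus B :=
  TensorProduct.lift ((LinearMap.lsmul ℂ (Bplus B)).compl₁₂ (counitB B) (plus B))

theorem counitPlus_tmul (a b : B) : counitPlus B (a ⊗ₜ b) = counitB B a • plus B b := rfl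

/-- The linear map `a ⊗ b ↦ a ⊗ b c - a b ⊗ c`. -/
def rshift (c : B) : B ⊗[ℂ] B →ₗ[ℂ] B ⊗[ℂ] B :=
  (LinearMap.mulRight ℂ c).lTensor B -
    (TensorProduct.mk ℂ B B).flip c ∘ₗ LinearMap.mul' ℂ B

theorem rshift_tmul (a b c : B) : rshift c (a ⊗ₜ[ℂ] b) = a ⊗ₜ (b * c) - (a * b) ⊗ₜ c := rfl

theorem coe_formLin_rshift (c : B) (t : B ⊗[ℂ] B) :
    (δ.formLin (rshift c t) : δ.M) = op c • (δ.formLin t : δ.M) := by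
  induction t with
  | zero => simp
  | add x y hx hy => simp [hx, hy]
  | tmul a b =>
    rw [rshift_tmul, map_sub, formLin_tmul, formLin_tmul, formLin_tmul]
    change a • δ.d (b * c) - (a * b) • δ.d c = op c • a • δ.d b
    rw [δ.leibniz, smul_add, smul_smul, ← smul_comm a (op c), add_sub_cancel_left]

theorem counitPlus_rshift (c : B) (t : B ⊗[ℂ] B) :
    counitPlus B (rshift c t) = rmul B c (counitPlus B t) := by
  induction t with
  | zero => simp
  | add x y hx hy => simp [hx, hy]
  | tmul a b =>
    rw [rshift_tmul, map_sub, counitPlus_tmul, counitPlus_tmul, counitPlus_tmul]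
    apply Subtype.ext
    simp [coe_rmul, coe_plus, counitB_mul, smul_sub, sub_mul, smul_smul, mul_assoc]

/-- The right ideal `R_δ = {∑ ε(aᵢ) bᵢ⁺ | ∑ aᵢ δ bᵢ = 0}` of `B⁺`. -/
def toRightIdeal : RightIdeal B where
  carrier := (LinearMap.ker δ.formLin).map (counitPlus B)
  mul_mem := by
    rintro _ ⟨t, ht, rfl⟩ c
    refine ⟨rshift (c : B) t, ?_, counitPlus_rshift _ _⟩
    have ht' : δ.formLin t = 0 := ht
    change δ.formLin _ = 0
    apply Subtype.ext
    rw [coe_formLin_rshift, ht']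
    simp

variable {δ δ'} in
theorem toRightIdeal_anti (h : δ ≤ δ') :
    δ'.toRightIdeal.carrier ≤ δ.toRightIdeal.carrier := by
  obtain ⟨φ, hφ⟩ := h
  apply Submodule.map_mono
  intro t ht
  have key : φ ∘ₗ δ'.formLin = δ.formLin := by
    ext a b
    simp [formLin_tmul, hφ]
  have ht' : δ'.formLin t = 0 := ht
  change δ.formLin t = 0
  rw [← key, LinearMap.comp_apply, ht', map_zero]

end Deriv

section Construction

variable {B : Subalgebra ℂ A} (R : RightIdeal B)

/-- Right multiplication of `B` on `B⁺ / R`. -/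
def rmulQ : B →ₗ[ℂ] Module.End ℂ (Bplus B ⧸ R.carrier) where
  toFun c := R.carrier.mapQ R.carrier (rmul B c) (fun _ hr => R.rmul_mem c hr)
  map_add' c c' := by
    ext x
    simp only [LinearMap.comp_apply, Submodule.mkQ_apply, Submodule.mapQ_apply,
      LinearMap.add_apply, ← Submodule.Quotient.mk_add]
    congr 1
    exact Subtype.ext (mul_add _ _ _)
  map_smul' z c := by
    ext x
    simp only [LinearMap.comp_apply, Submodule.mkQ_apply, Submodule.mapQ_apply,
      LinearMap.smul_apply, ← Submodule.Quotient.mk_smul, RingHom.id_apply]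
    congr 1
    exact Subtype.ext (mul_smul_comm _ _ _)

theorem rmulQ_mk (c : B) (x : Bplus B) :
    rmulQ R c (R.carrier.mkQ x) = R.carrier.mkQ (rmul B c x) := rfl

theorem rmulQ_one : rmulQ R 1 = LinearMap.id := by
  ext x
  simp only [LinearMap.comp_apply, rmulQ_mk, LinearMap.id_apply]
  congr 1
  exact Subtype.ext (mul_one _)

theorem rmulQ_mul (b c : B) : rmulQ R (b * c) = rmulQ R c ∘ₗ rmulQ R b := by
  ext x
  simp only [LinearMap.comp_apply, rmulQ_mk]
  congr 1
  exact Subtype.ext (mul_assoc _ _ _).symm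

/-- The right action of `A ⊗ B` on `A ⊗ (B⁺ / R)`, `(a ⊗ v) (x ⊗ b) = a x ⊗ v b`. -/
def ract : A ⊗[ℂ] B →ₗ[ℂ] Module.End ℂ (A ⊗[ℂ] (Bplus B ⧸ R.carrier)) :=
  TensorProduct.homTensorHomMap (.id ℂ) A (Bplus B ⧸ R.carrier) A (Bplus B ⧸ R.carrier) ∘ₗ
    TensorProduct.map (LinearMap.mul ℂ A).flip (rmulQ R)

theorem ract_tmul (x a : A) (b : B) (v : Bplus B ⧸ R.carrier) :
    ract R (x ⊗ₜ b) (a ⊗ₜ v) = (a * x) ⊗ₜ rmulQ R b v := rfl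

theorem ract_one : ract R 1 = 1 := by
  ext a v
  simp [Algebra.TensorProduct.one_def, ract_tmul, rmulQ_one]

theorem ract_mul (s t : A ⊗[ℂ] B) : ract R (s * t) = ract R t * ract R s := by
  induction s with
  | zero => simp
  | add x y hx hy => simp [add_mul, mul_add, hx, hy]
  | tmul x b =>
    induction t with
    | zero => simp
    | add x y hx hy => simp [add_mul, mul_add, hx, hy]
    | tmul y c =>
      ext a v
      simp [ract_tmul, rmulQ_mul, mul_assoc]

/-- The right `B`-module structure `(a ⊗ v) c = a c₍₁₎ ⊗ v c₍₂₎` of `A ⊗ (B⁺ / R)`. -/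
abbrev rightModuleOf (hB : IsLeftCoideal B) :
    Module Bᵐᵒᵖ (A ⊗[ℂ] (Bplus B ⧸ R.carrier)) where
  smul c x := ract R (coactLin hB c.unop) x
  one_smul x := by
    change ract R (coactLin hB 1) x = x
    rw [coactLin_one, ract_one]; rfl
  mul_smul c c' x := by
    change ract R (coactLin hB (c'.unop * c.unop)) x = _
    rw [coactLin_mul, ract_mul]; rfl
  smul_zero c := map_zero (ract R (coactLin hB c.unop))
  smul_add c := map_add (ract R (coactLin hB c.unop))
  add_smul c c' x := by
    change ract R (coactLin hB (c.unop + c'.unop)) x = _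
    rw [map_add, map_add]; rfl
  zero_smul x := by
    change ract R (coactLin hB 0) x = 0
    rw [map_zero, map_zero]; rfl

/-- The linear map `b ↦ b₍₁₎ ⊗ p(b₍₂₎⁺)`, where `p : B⁺ → B⁺ / R` is the projection. -/
def dLin (hB : IsLeftCoideal B) : B →ₗ[ℂ] A ⊗[ℂ] (Bplus B ⧸ R.carrier) :=
  (R.carrier.mkQ ∘ₗ plus B).lTensor A ∘ₗ coactLin hB

theorem plus_mul (b c : B) :
    plus B (b * c) = rmul B c (plus B b) + counitB B b • plus B c := by
  apply Subtype.ext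
  simp [coe_rmul, coe_plus, counitB_mul, smul_sub, sub_mul, smul_smul]

theorem lTensor_plus_mul (s t : A ⊗[ℂ] B) :
    (R.carrier.mkQ ∘ₗ plus B).lTensor A (s * t) =
      (LinearMap.mulLeft ℂ (TensorProduct.rid ℂ A ((counitB B).lTensor A s))).rTensor _
        ((R.carrier.mkQ ∘ₗ plus B).lTensor A t) +
      ract R t ((R.carrier.mkQ ∘ₗ plus B).lTensor A s) := by
  induction s with
  | zero => simp [LinearMap.rTensor_zero]
  | add x y hx hy =>
    have h (a a' : A) : LinearMap.mulLeft ℂ (a + a') =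
        LinearMap.mulLeft ℂ a + LinearMap.mulLeft ℂ a' := by ext; simp [add_mul]
    simp only [add_mul, map_add, hx, hy, h, LinearMap.rTensor_add, LinearMap.add_apply]
    abel
  | tmul x b =>
    induction t with
    | zero => simp
    | add x y hx hy =>
      simp only [mul_add, map_add, hx, hy, LinearMap.add_apply]
      abel
    | tmul y c =>
      simp only [Algebra.TensorProduct.tmul_mul_tmul, LinearMap.lTensor_tmul,
        LinearMap.comp_apply, plus_mul, map_add, map_smul, TensorProduct.tmul_add, ract_tmul,
        rmulQ_mk, TensorProduct.rid_tmul, LinearMap.rTensor_tmul, LinearMap.mulLeft_apply,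
        TensorProduct.tmul_smul, smul_mul_assoc, TensorProduct.smul_tmul']
      abel

/-- The derivation `δ_R`, given by `a δ b = a b₍₁₎ ⊗ p(b₍₂₎⁺)`; the bimodule structure of
`A ⊗ (B⁺ / R)` is `b (a ⊗ v) c = b a c₍₁₎ ⊗ v c₍₂₎`. -/
def derivOf (hB : IsLeftCoideal B) : Deriv B :=
  letI := rightModuleOf R hB
  { M := A ⊗[ℂ] (Bplus B ⧸ R.carrier)
    rightTower := ⟨fun z c x => by
      change ract R (coactLin hB (z • c.unop)) x = z • ract R (coactLin hB c.unop) x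
      rw [map_smul, map_smul]; rfl⟩
    bimodule := ⟨fun b c x => by
      change b • ract R (coactLin hB c.unop) x = ract R (coactLin hB c.unop) (b • x)
      generalize coactLin hB c.unop = t
      induction x with
      | zero => simp
      | add x y hx hy => simp only [map_add, smul_add, hx, hy]
      | tmul a v =>
        induction t with
        | zero => simp
        | add x y hx hy => simp only [map_add, smul_add, LinearMap.add_apply, hx, hy]
        | tmul x c =>
          change (b • (a * x)) ⊗ₜ[ℂ] rmulQ R c v = ((b • a) * x) ⊗ₜ[ℂ] rmulQ R c v
          rw [smul_mul_assoc]⟩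
    d := dLin R hB
    leibniz := fun b c => by
      change (R.carrier.mkQ ∘ₗ plus B).lTensor A (coactLin hB (b * c)) =
        b • dLin R hB c + ract R (coactLin hB c) (dLin R hB b)
      rw [coactLin_mul, lTensor_plus_mul, counit_coactLin]
      congr 1 }

end Construction

variable (B : Subalgebra ℂ A)

/-- Derivations of `B`, where `δ` and `δ'` are considered identical if `δ ≤ δ'` and `δ' ≤ δ`. -/
abbrev DerivClass : Type (u + 1) := Antisymmetrization (Deriv B) (· ≤ ·)

variable {B}

/-- A derivation, up to identification, is equivariant. -/
def DerivClass.IsEquivariant (hB : IsLeftCoideal B) (δ : DerivClass B) : Prop :=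
  Quotient.liftOn δ (fun δ => δ.IsEquivariant hB) fun _ _ h =>
    propext ⟨fun h' => h'.congr h.1 h.2, fun h' => h'.congr h.2 h.1⟩

/-- The map `δ ↦ R_δ`. -/
def DerivClass.toRightIdeal (δ : DerivClass B) : RightIdeal B :=
  Quotient.liftOn δ Deriv.toRightIdeal fun _ _ h =>
    RightIdeal.ext (le_antisymm (Deriv.toRightIdeal_anti h.2) (Deriv.toRightIdeal_anti h.1))

/-- The map `R ↦ δ_R`. -/
def RightIdeal.toDeriv (hB : IsLeftCoideal B) (R : RightIdeal B) : DerivClass B :=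
  toAntisymmetrization (· ≤ ·) (derivOf R hB)

end Derivations

end QHS

end

noncomputable section

namespace QHS

open MulOpposite

/-! A derivation, up to identification, is the kernel of `formLin : B ⊗ B → Γ(δ)`: order is reverse
inclusion of kernels (`le_iff`), and equivariance says that the diagonal coaction maps the kernel
into A ⊗ kernel (`isEquivariant_iff`). If δ is equivariant and ∑ a δ b = 0, applying ε ⊗ (·)⁺ to the
coacted relation gives ∑ a b₁ ⊗ b₂⁺ ∈ A ⊗ R_δ (`diagCoact_mem`). Projecting A to Ā yields stability
of R_δ; projecting B⁺ to B⁺/R_δ yields δ_{R_δ} ≤ δ. Conversely, δ_R is equivariant by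
coassociativity, and ε ⊗ id shows that R_{δ_R} ⊆ R.

The other two inclusions need the antipode and faithful flatness. For R ⊆ R_{δ_R}, take S(r₁) ⊗ δ_R
r₂ in A ⊗_B Γ(δ_R). In A ⊗_B (A ⊗ B⁺/R) it is the image of δ_R r under a ⊗ v ↦ S(a₁) ⊗ (a₂ ⊗ v), a
map that factors through Ā ⊗ B⁺/R, where stability kills δ_R r. Flatness makes the element itself
zero, and applying ε to both factors returns the class of r. For δ ≤ δ_{R_δ}, the map a ⊗ p(b⁺) ↦ a
S(b₁) ⊗ δ b₂ into A ⊗_B M is well defined and sends a δ_{R_δ} b to a ⊗ δ b. Thus a relation of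
δ_{R_δ} holds for δ after tensoring with A, hence before, by faithfulness. -/

theorem exists_comp_eq_of_ker_le {X Y Z : Type*} [AddCommGroup X] [Module ℂ X] [AddCommGroup Y]
    [Module ℂ Y] [AddCommGroup Z] [Module ℂ Z] {f : X →ₗ[ℂ] Y} (hf : Function.Surjective f)
    {g : X →ₗ[ℂ] Z} (h : ∀ x, f x = 0 → g x = 0) : ∃ φ : Y →ₗ[ℂ] Z, ∀ x, φ (f x) = g x := by
  refine ⟨(LinearMap.ker f).liftQ g (fun x hx => h x hx) ∘ₗ
    (f.quotKerEquivOfSurjective hf).symm.toLinearMap, fun x => ?_⟩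
  have hx : (f.quotKerEquivOfSurjective hf).symm (f x) = (LinearMap.ker f).mkQ x := by
    rw [LinearEquiv.symm_apply_eq]
    rfl
  rw [LinearMap.comp_apply, LinearEquiv.coe_coe, hx]
  rfl

/-- Tensoring over a field is exact: factor f through its range, use right exactness for the
surjection and flatness for the inclusion. -/
theorem exists_lTensor_ker_subtype {X Y P : Type*} [AddCommGroup X] [Module ℂ X] [AddCommGroup Y]
    [Module ℂ Y] [AddCommGroup P] [Module ℂ P] (f : X →ₗ[ℂ] Y) {x : P ⊗[ℂ] X}
    (hx : f.lTensor P x = 0) : ∃ y, (LinearMap.ker f).subtype.lTensor P y = x := by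
  have hinj : Function.Injective ((LinearMap.range f).subtype.lTensor P) :=
    Module.Flat.lTensor_preserves_injective_linearMap _ Subtype.val_injective
  refine (lTensor_exact P (f := (LinearMap.ker f).subtype) (g := f.rangeRestrict)
    (fun z => ?_) f.surjective_rangeRestrict x).1 (hinj ?_)
  · simp [Subtype.ext_iff]
  · rw [← LinearMap.comp_apply, ← LinearMap.lTensor_comp, map_zero]
    exact hx

/-! ### The coaction B → A ⊗ B and the quotient Ā. -/

section Coaction

variable {A : Type u} [Ring A] [HopfAlgebra ℂ A] {B : Subalgebra ℂ A} (hB : IsLeftCoideal B)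

/-- Inherited from Δ, since A ⊗ (A ⊗ B) embeds in A ⊗ (A ⊗ A). -/
theorem coactLin_coassoc (b : B) :
    TensorProduct.assoc ℂ A A B ((Coalgebra.comul (R := ℂ)).rTensor B (coactLin hB b)) =
      (coactLin hB).lTensor A (coactLin hB b) := by
  have hinj : Function.Injective ((B.val.toLinearMap.lTensor A).lTensor A) :=
    Module.Flat.lTensor_preserves_injective_linearMap _ (lTensor_val_injective B)
  apply hinj
  have h₁ (s : A ⊗[ℂ] B) : (B.val.toLinearMap.lTensor A).lTensor A ((coactLin hB).lTensor A s) =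
      (Coalgebra.comul (R := ℂ)).lTensor A (B.val.toLinearMap.lTensor A s) := by
    induction s with
    | zero => simp
    | add x y hx hy => simp only [map_add, hx, hy]
    | tmul x b => simp only [LinearMap.lTensor_tmul, lTensor_coactLin]; rfl
  have h₂ (s : (A ⊗[ℂ] A) ⊗[ℂ] B) : (B.val.toLinearMap.lTensor A).lTensor A
      (TensorProduct.assoc ℂ A A B s) =
      TensorProduct.assoc ℂ A A A (B.val.toLinearMap.lTensor (A ⊗[ℂ] A) s) := by
    have : (B.val.toLinearMap.lTensor A).lTensor A ∘ₗ
        (TensorProduct.assoc ℂ A A B).toLinearMap =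
        (TensorProduct.assoc ℂ A A A).toLinearMap ∘ₗ B.val.toLinearMap.lTensor (A ⊗[ℂ] A) := by
      ext; rfl
    exact LinearMap.congr_fun this s
  rw [h₁, h₂, lTensor_coactLin, ← Coalgebra.coassoc_apply, ← lTensor_coactLin hB,
    ← LinearMap.comp_apply (LinearMap.lTensor _ _), LinearMap.lTensor_comp_rTensor,
    ← LinearMap.comp_apply (LinearMap.rTensor _ _), LinearMap.rTensor_comp_lTensor]

theorem counit_rTensor_coactLin (b : B) :
    (Coalgebra.counit (R := ℂ)).rTensor B (coactLin hB b) = 1 ⊗ₜ[ℂ] b := by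
  have hinj : Function.Injective (B.val.toLinearMap.lTensor ℂ) :=
    Module.Flat.lTensor_preserves_injective_linearMap _ Subtype.val_injective
  apply hinj
  have h := Coalgebra.rTensor_counit_comul (R := ℂ) (b : A)
  rw [← lTensor_coactLin hB, ← LinearMap.comp_apply, LinearMap.rTensor_comp_lTensor] at h
  rw [← LinearMap.comp_apply, LinearMap.lTensor_comp_rTensor, h]
  rfl

theorem mul_antipode_val_coactLin (b : B) :
    LinearMap.mul' ℂ A (TensorProduct.map (HopfAlgebra.antipode ℂ) B.val.toLinearMap
      (coactLin hB b)) = algebraMap ℂ A (counitB B b) := by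
  have h := HopfAlgebra.mul_antipode_rTensor_comul_apply (R := ℂ) (b : A)
  rw [← lTensor_coactLin hB, ← LinearMap.comp_apply (LinearMap.rTensor _ _),
    LinearMap.rTensor_comp_lTensor] at h
  exact h

variable (B) in
theorem mkQ_mul_eq_smul (b : B) (a : A) :
    (BplusA B).mkQ (b * a) = counitB B b • (BplusA B).mkQ a := by
  rw [← map_smul, ← sub_eq_zero, ← map_sub, Submodule.mkQ_apply, Submodule.Quotient.mk_eq_zero]
  refine Submodule.subset_span ⟨plus B b, (plus B b).2, a, ?_⟩
  rw [coe_plus]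
  simp [sub_mul]

theorem plus_coe (x : Bplus B) : plus B (x : B) = x := by
  apply Subtype.ext
  rw [coe_plus, show counitB B x = 0 from x.2]
  simp

theorem val_plus (b : B) :
    B.val.toLinearMap ((Bplus B).subtype (plus B b)) = (b : A) - counitB B b • (1 : A) := rfl

theorem comulBar_one : comulBar B 1 = (BplusA B).mkQ 1 ⊗ₜ 1 := by
  rw [comulBar, LinearMap.comp_apply, Bialgebra.comul_one]
  rfl

theorem comulBar_val (b : B) : comulBar B (b : A) =
    TensorProduct.map (BplusA B).mkQ B.val.toLinearMap (coactLin hB b) := by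
  rw [comulBar, LinearMap.comp_apply, ← lTensor_coactLin hB,
    ← LinearMap.comp_apply, LinearMap.rTensor_comp_lTensor]

end Coaction

/-! ### Consequences of faithful flatness. -/

section Flat

variable {A : Type u} [Ring A] [Algebra ℂ A] {B : Subalgebra ℂ A}
variable {M N : Type u} [AddCommGroup M] [Module ℂ M] [Module B M] [IsScalarTower ℂ B M]
  [AddCommGroup N] [Module ℂ N] [Module B N] [IsScalarTower ℂ B N]

variable (B) in
/-- The class of `a ⊗ m` in `A ⊗_B M`. -/
def mkB (M : Type u) [AddCommGroup M] [Module ℂ M] [Module B M] : A ⊗[ℂ] M →ₗ[ℂ] TensorB B M :=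
  (balanced B M).mkQ

theorem mkB_mul_tmul {M : Type u} [AddCommGroup M] [Module ℂ M] [Module B M] (a : A)
    (b : B) (m : M) : mkB B M ((a * b) ⊗ₜ m) = mkB B M (a ⊗ₜ (b • m)) :=
  (Submodule.Quotient.eq _).2 (Submodule.subset_span ⟨a, b, m, rfl⟩)

theorem tensorBMap_mkB (f : M →ₗ[B] N) (x : A ⊗[ℂ] M) :
    tensorBMap f (mkB B M x) = mkB B N ((f.restrictScalars ℂ).lTensor A x) := rfl

theorem IsFaithfullyFlatRight.tensorBMap_injective (h : IsFaithfullyFlatRight B) {f : M →ₗ[B] N}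
    (hf : Function.Injective f) : Function.Injective (tensorBMap f) := by
  rw [injective_iff_map_eq_zero]
  intro x hx
  have hex : Function.Exact (0 : M →ₗ[B] M) f := fun y => by
    simp [map_eq_zero_iff f hf, eq_comm]
  obtain ⟨y, rfl⟩ := ((h M M N 0 f).1 hex x).1 hx
  obtain ⟨y, rfl⟩ := Submodule.mkQ_surjective _ y
  change tensorBMap 0 (mkB B M y) = 0
  rw [tensorBMap_mkB]
  simp

/-- The sequence M → M → M with both maps zero is exact only if M = 0. -/
theorem IsFaithfullyFlatRight.subsingleton (h : IsFaithfullyFlatRight B)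
    (hM : Subsingleton (TensorB B M)) : Subsingleton M := by
  have hex := (h M M M 0 0).2 fun x =>
    ⟨fun _ => ⟨0, Subsingleton.elim _ _⟩, fun _ => Subsingleton.elim _ _⟩
  refine ⟨fun x y => ?_⟩
  obtain ⟨_, rfl⟩ := (hex x).1 rfl
  obtain ⟨_, rfl⟩ := (hex y).1 rfl
  rfl

/-- A ⊗_B Bm embeds in A ⊗_B M, where its generators a ⊗ bm = ab ⊗ m vanish; so A ⊗_B Bm = 0 and
hence Bm = 0. -/
theorem IsFaithfullyFlatRight.eq_zero_of_mkB_eq_zero (h : IsFaithfullyFlatRight B) {m : M}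
    (hm : ∀ a : A, mkB B M (a ⊗ₜ m) = 0) : m = 0 := by
  let N := Submodule.span B {m}
  have hN : Subsingleton (TensorB B N) := by
    refine subsingleton_of_forall_eq 0 fun x => ?_
    obtain ⟨x, rfl⟩ := Submodule.mkQ_surjective _ x
    apply h.tensorBMap_injective N.subtype_injective
    change tensorBMap N.subtype (mkB B N x) = _
    rw [tensorBMap_mkB, map_zero]
    induction x with
    | zero => simp
    | add x y hx hy => rw [map_add, map_add, hx, hy, add_zero]
    | tmul a n =>
      obtain ⟨n, hn⟩ := n
      obtain ⟨b, rfl⟩ := Submodule.mem_span_singleton.1 hn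
      change mkB B M (a ⊗ₜ (b • m)) = 0
      rw [← mkB_mul_tmul, hm]
  have := h.subsingleton hN
  exact congrArg Subtype.val
    (Subsingleton.elim (⟨m, Submodule.mem_span_singleton_self m⟩ : N) 0)

end Flat

/-! ### Derivations as kernels in B ⊗ B, and stability of R_δ. -/

section Derivations

variable {A : Type u} [Ring A] [HopfAlgebra ℂ A] {B : Subalgebra ℂ A}

theorem counitPlus_one_tmul (x : Bplus B) : Deriv.counitPlus B (1 ⊗ₜ (x : B)) = x := by
  rw [Deriv.counitPlus_tmul, counitB_one, one_smul, plus_coe]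

namespace Deriv

variable (δ δ' : Deriv B)

theorem d_one : δ.d 1 = 0 := by
  have h := δ.leibniz 1 1
  rw [mul_one, op_one, one_smul, one_smul] at h
  simpa using h

/-- `Γ(δ)` is a left `B`-module. -/
instance : SMul B δ.Gamma where
  smul b x := ⟨b • (x : δ.M), by
    obtain ⟨t, rfl⟩ := δ.formLin_surjective x
    induction t with
    | zero => simp
    | add x y hx hy =>
      simpa only [map_add, Submodule.coe_add, smul_add] using δ.Gamma.add_mem hx hy
    | tmul a c =>
      refine Submodule.subset_span ⟨b * a, c, ?_⟩
      rw [mul_smul]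
      rfl⟩

instance : Module B δ.Gamma :=
  Subtype.val_injective.module B δ.Gamma.subtype.toAddMonoidHom (fun _ _ => rfl)

instance : IsScalarTower ℂ B δ.Gamma :=
  ⟨fun z b x => Subtype.ext (smul_assoc z b (x : δ.M))⟩

theorem smul_formLin (b : B) (t : B ⊗[ℂ] B) :
    b • δ.formLin t = δ.formLin ((LinearMap.mulLeft ℂ b).rTensor B t) := by
  induction t with
  | zero => simp
  | add x y hx hy => simp only [map_add, smul_add, hx, hy]
  | tmul a c => exact Subtype.ext (mul_smul b a (δ.d c)).symm

theorem counitPlus_mulLeft (b : B) (t : B ⊗[ℂ] B) :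
    counitPlus B ((LinearMap.mulLeft ℂ b).rTensor B t) = counitB B b • counitPlus B t := by
  induction t with
  | zero => simp
  | add x y hx hy => simp only [map_add, smul_add, hx, hy]
  | tmul a c => simp [counitPlus_tmul, counitB_mul, mul_smul]

variable {δ δ'} in
theorem le_iff : δ ≤ δ' ↔ ∀ t, δ'.formLin t = 0 → δ.formLin t = 0 := by
  constructor
  · rintro ⟨φ, hφ⟩ t ht
    have key : φ ∘ₗ δ'.formLin = δ.formLin := by
      ext a b
      simp [formLin_tmul, hφ]
    rw [← key, LinearMap.comp_apply, ht, map_zero]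
  · intro h
    obtain ⟨φ, hφ⟩ := exists_comp_eq_of_ker_le δ'.formLin_surjective h
    exact ⟨φ, fun a b => hφ (a ⊗ₜ b)⟩

/-- The map `(x ⊗ a) ⊗ (y ⊗ b) ↦ x y ⊗ (a ⊗ b)`. -/
def diagMul (B : Subalgebra ℂ A) : (A ⊗[ℂ] B) ⊗[ℂ] (A ⊗[ℂ] B) →ₗ[ℂ] A ⊗[ℂ] (B ⊗[ℂ] B) :=
  (LinearMap.mul' ℂ A).rTensor (B ⊗[ℂ] B) ∘ₗ
    (TensorProduct.tensorTensorTensorComm ℂ A B A B).toLinearMap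

theorem lTensor_formLin_diagMul (s : (A ⊗[ℂ] B) ⊗[ℂ] (A ⊗[ℂ] B)) :
    δ.formLin.lTensor A (diagMul B s) = δ.diagForm s := by
  rw [diagMul, diagForm, LinearMap.comp_apply, LinearMap.comp_apply,
    ← LinearMap.comp_apply (LinearMap.lTensor _ _), LinearMap.lTensor_comp_rTensor]

/-- The diagonal coaction `a ⊗ b ↦ a₍₁₎ b₍₁₎ ⊗ (a₍₂₎ ⊗ b₍₂₎)` of `A` on `B ⊗ B`. -/
def diagCoact (hB : IsLeftCoideal B) : B ⊗[ℂ] B →ₗ[ℂ] A ⊗[ℂ] (B ⊗[ℂ] B) :=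
  diagMul B ∘ₗ TensorProduct.map (coactLin hB) (coactLin hB)

theorem lTensor_formLin_diagCoact_tmul (hB : IsLeftCoideal B) (a b : B) :
    δ.formLin.lTensor A (diagCoact hB (a ⊗ₜ b)) = δ.diagForm (coactLin hB a ⊗ₜ coactLin hB b) :=
  lTensor_formLin_diagMul δ _

variable {δ} in
theorem isEquivariant_iff {hB : IsLeftCoideal B} : δ.IsEquivariant hB ↔
    ∀ t, δ.formLin t = 0 → δ.formLin.lTensor A (diagCoact hB t) = 0 := by
  constructor
  · rintro ⟨Φ, hΦ⟩ t ht
    have key : Φ ∘ₗ δ.formLin = δ.formLin.lTensor A ∘ₗ diagCoact hB := by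
      ext a b
      simpa [formLin_tmul, hΦ] using (lTensor_formLin_diagCoact_tmul δ hB a b).symm
    rw [← LinearMap.comp_apply, ← key, LinearMap.comp_apply, ht, map_zero]
  · intro h
    obtain ⟨Φ, hΦ⟩ := exists_comp_eq_of_ker_le (g := δ.formLin.lTensor A ∘ₗ diagCoact hB)
      δ.formLin_surjective h
    exact ⟨Φ, fun a b => (hΦ (a ⊗ₜ b)).trans (lTensor_formLin_diagCoact_tmul δ hB a b)⟩

theorem lTensor_counitPlus_diagMul (u w : A ⊗[ℂ] B) :
    (counitPlus B).lTensor A (diagMul B (u ⊗ₜ w)) =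
      (LinearMap.mulLeft ℂ (TensorProduct.rid ℂ A ((counitB B).lTensor A u))).rTensor _
        ((plus B).lTensor A w) := by
  induction u with
  | zero => simp [LinearMap.rTensor_zero]
  | add x y hx hy =>
    have h (a a' : A) : LinearMap.mulLeft ℂ (a + a') =
        LinearMap.mulLeft ℂ a + LinearMap.mulLeft ℂ a' := by ext; simp [add_mul]
    simp only [TensorProduct.add_tmul, map_add, hx, hy, h, LinearMap.rTensor_add,
      LinearMap.add_apply]
  | tmul x a =>
    induction w with
    | zero => simp
    | add x y hx hy => simp only [TensorProduct.tmul_add, map_add, hx, hy]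
    | tmul y b => simp [diagMul, counitPlus_tmul, TensorProduct.smul_tmul']

/-- The counit collapses a₁ ε(a₂) to a, leaving a b₁ ⊗ b₂⁺, a lift of a δ_R b that does not depend
on R. -/
theorem lTensor_counitPlus_diagCoact_tmul (hB : IsLeftCoideal B) (a b : B) :
    (counitPlus B).lTensor A (diagCoact hB (a ⊗ₜ b)) =
      (LinearMap.mulLeft ℂ (a : A)).rTensor _ ((plus B).lTensor A (coactLin hB b)) := by
  rw [← counit_coactLin hB a, ← lTensor_counitPlus_diagMul]
  rfl

/-- Left multiplication by elements of B acts on Ā through ε, so a b₁ ⊗ b₂⁺ becomes ε(a) (Δ̄(b) -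
ε(b) 1̄ ⊗ 1) = Δ̄(ε(a) b⁺). -/
theorem map_mkQ_counitPlus_diagCoact (hB : IsLeftCoideal B) (t : B ⊗[ℂ] B) :
    TensorProduct.map (BplusA B).mkQ (B.val.toLinearMap ∘ₗ (Bplus B).subtype)
      ((counitPlus B).lTensor A (diagCoact hB t)) = comulBar B (counitPlus B t : B) := by
  induction t with
  | zero => simp
  | add x y hx hy => simp only [map_add, hx, hy, Submodule.coe_add, Subalgebra.coe_add]
  | tmul a b =>
    rw [lTensor_counitPlus_diagCoact_tmul, counitPlus_tmul]
    have h₁ (s : A ⊗[ℂ] B) : TensorProduct.map (BplusA B).mkQ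
        (B.val.toLinearMap ∘ₗ (Bplus B).subtype)
        ((LinearMap.mulLeft ℂ (a : A)).rTensor _ ((plus B).lTensor A s)) =
        counitB B a • (TensorProduct.map (BplusA B).mkQ B.val.toLinearMap s -
          (BplusA B).mkQ (TensorProduct.rid ℂ A ((counitB B).lTensor A s)) ⊗ₜ 1) := by
      induction s with
      | zero => simp
      | add x y hx hy =>
        simp only [map_add, hx, hy, TensorProduct.add_tmul, smul_sub, smul_add]
        abel
      | tmul x c =>
        simp only [LinearMap.lTensor_tmul, LinearMap.rTensor_tmul, TensorProduct.map_tmul,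
          LinearMap.mulLeft_apply, mkQ_mul_eq_smul, LinearMap.comp_apply, val_plus,
          TensorProduct.rid_tmul, map_smul, TensorProduct.tmul_sub, TensorProduct.tmul_smul,
          TensorProduct.smul_tmul', smul_sub, smul_comm (counitB B c)]
        rfl
    rw [h₁, counit_coactLin, ← comulBar_val]
    have h₂ := mkQ_mul_eq_smul B b 1
    rw [mul_one] at h₂
    have h₃ : (((counitB B a • plus B b : Bplus B) : B) : A) =
      counitB B a • ((b : A) - counitB B b • (1 : A)) := rfl
    rw [h₂, h₃, map_smul, map_sub, map_smul, comulBar_one, TensorProduct.smul_tmul']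

variable {δ} in
-- The coacted relation lies in A ⊗ ker, and `counitPlus` maps the kernel onto R_δ by definition.
-- Both the stability of R_δ and δ_{R_δ} ≤ δ follow from this.
theorem IsEquivariant.diagCoact_mem {hB : IsLeftCoideal B} (h : δ.IsEquivariant hB)
    {t : B ⊗[ℂ] B} (ht : δ.formLin t = 0) : (counitPlus B).lTensor A (diagCoact hB t) ∈
      LinearMap.range (δ.toRightIdeal.carrier.subtype.lTensor A) := by
  obtain ⟨y, hy⟩ := exists_lTensor_ker_subtype δ.formLin (isEquivariant_iff.1 h t ht)
  let f : LinearMap.ker δ.formLin →ₗ[ℂ] δ.toRightIdeal.carrier :=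
    (counitPlus B).restrict (fun x hx => ⟨x, hx, rfl⟩)
  refine ⟨f.lTensor A y, ?_⟩
  rw [← hy, ← LinearMap.comp_apply, ← LinearMap.comp_apply, ← LinearMap.lTensor_comp,
    ← LinearMap.lTensor_comp]
  rfl

variable {δ} in
theorem IsEquivariant.isStable_toRightIdeal {hB : IsLeftCoideal B} (h : δ.IsEquivariant hB) :
    δ.toRightIdeal.IsStable := by
  rintro ⟨r, t, ht, rfl⟩
  obtain ⟨y, hy⟩ := h.diagCoact_mem ht
  refine ⟨(BplusA B).mkQ.rTensor _ y, ?_⟩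
  refine Eq.trans ?_ (map_mkQ_counitPlus_diagCoact hB t)
  rw [← hy, ← LinearMap.comp_apply, LinearMap.lTensor_comp_rTensor, ← LinearMap.comp_apply,
    LinearMap.map_comp_lTensor]
  rfl

end Deriv

/-! ### Γ(δ_R) inside A ⊗ (B⁺ / R). -/

section Construction

variable (R : RightIdeal B) (hB : IsLeftCoideal B)

/-- The inclusion of `Γ(δ_R)` into `A ⊗ (B⁺ / R)`. -/
def GammaIncl : (derivOf R hB).Gamma →ₗ[B] A ⊗[ℂ] (Bplus B ⧸ R.carrier) where
  toFun x := x.1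
  map_add' _ _ := rfl
  map_smul' _ _ := rfl

theorem GammaIncl_injective : Function.Injective (GammaIncl R hB) := Subtype.val_injective

theorem GammaIncl_formLin_tmul (a b : B) : GammaIncl R hB ((derivOf R hB).formLin (a ⊗ₜ b)) =
    (LinearMap.mulLeft ℂ (a : A)).rTensor _ (dLin R hB b) := rfl

theorem GammaIncl_formLin (t : B ⊗[ℂ] B) : GammaIncl R hB ((derivOf R hB).formLin t) =
    R.carrier.mkQ.lTensor A ((Deriv.counitPlus B).lTensor A (Deriv.diagCoact hB t)) := by
  induction t with
  | zero => simp
  | add x y hx hy => simp only [map_add, hx, hy]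
  | tmul a b =>
    rw [Deriv.lTensor_counitPlus_diagCoact_tmul, GammaIncl_formLin_tmul, dLin,
      LinearMap.comp_apply, LinearMap.lTensor_comp, LinearMap.comp_apply,
      ← LinearMap.comp_apply, LinearMap.rTensor_comp_lTensor, ← LinearMap.lTensor_comp_rTensor]
    rfl

theorem formLin_derivOf_eq_zero_iff (t : B ⊗[ℂ] B) : (derivOf R hB).formLin t = 0 ↔
    GammaIncl R hB ((derivOf R hB).formLin t) = 0 :=
  (map_eq_zero_iff _ (GammaIncl_injective R hB)).symm

end Construction

end Derivations

/-! ### Equivariance of δ_R, and the identity R_{δ_R} = R. -/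

section Bijection

variable {A : Type u} [Ring A] [HopfAlgebra ℂ A] {B : Subalgebra ℂ A}
variable (R : RightIdeal B) (hB : IsLeftCoideal B)

/-- The left action of `A ⊗ A` on `A ⊗ (A ⊗ V)`. -/
def lact₂ (V : Type*) [AddCommGroup V] [Module ℂ V] :
    A ⊗[ℂ] A →ₗ[ℂ] Module.End ℂ (A ⊗[ℂ] (A ⊗[ℂ] V)) :=
  TensorProduct.homTensorHomMap (.id ℂ) A (A ⊗[ℂ] V) A (A ⊗[ℂ] V) ∘ₗ
    TensorProduct.map (LinearMap.mul ℂ A) (LinearMap.rTensorHom V ∘ₗ LinearMap.mul ℂ A)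

theorem assoc_comul_mulLeft {V : Type*} [AddCommGroup V] [Module ℂ V] (a : A) (z : A ⊗[ℂ] V) :
    TensorProduct.assoc ℂ A A V ((Coalgebra.comul (R := ℂ)).rTensor V
      ((LinearMap.mulLeft ℂ a).rTensor V z)) =
    lact₂ V (Coalgebra.comul a)
      (TensorProduct.assoc ℂ A A V ((Coalgebra.comul (R := ℂ)).rTensor V z)) := by
  induction z with
  | zero => simp
  | add x y hx hy => simp only [map_add, hx, hy]
  | tmul c v =>
    simp only [LinearMap.rTensor_tmul, LinearMap.mulLeft_apply, Bialgebra.comul_mul]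
    generalize (Coalgebra.comul (R := ℂ) a) = s
    generalize (Coalgebra.comul (R := ℂ) c) = t
    induction s with
    | zero => simp
    | add x y hx hy =>
      simp only [add_mul, TensorProduct.add_tmul, map_add, LinearMap.add_apply, hx, hy]
    | tmul x y =>
      induction t with
      | zero => simp
      | add x y hx hy => simp only [mul_add, TensorProduct.add_tmul, map_add, hx, hy]
      | tmul x' y' =>
        rw [Algebra.TensorProduct.tmul_mul_tmul]
        rfl

theorem lTensor_dLin (b : B) : (dLin R hB).lTensor A (coactLin hB b) =
    TensorProduct.assoc ℂ A A _ ((Coalgebra.comul (R := ℂ)).rTensor _ (dLin R hB b)) := by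
  rw [dLin, LinearMap.lTensor_comp, LinearMap.comp_apply, ← coactLin_coassoc,
    LinearMap.comp_apply, ← LinearMap.comp_apply (LinearMap.rTensor (Bplus B ⧸ R.carrier) _),
    LinearMap.rTensor_comp_lTensor, ← LinearMap.lTensor_comp_rTensor, LinearMap.comp_apply]
  generalize (Coalgebra.comul (R := ℂ)).rTensor B (coactLin hB b) = s
  induction s with
  | zero => simp
  | add x y hx hy => simp only [map_add, hx, hy]
  | tmul x b =>
    induction x with
    | zero => simp
    | add x y hx hy => simp only [map_add, TensorProduct.add_tmul, hx, hy]
    | tmul x y => rfl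

theorem lTensor_GammaIncl_diagForm (u w : A ⊗[ℂ] B) :
    ((GammaIncl R hB).restrictScalars ℂ).lTensor A ((derivOf R hB).diagForm (u ⊗ₜ w)) =
      lact₂ _ (B.val.toLinearMap.lTensor A u) ((dLin R hB).lTensor A w) := by
  induction u with
  | zero => simp
  | add x y hx hy =>
    simp only [TensorProduct.add_tmul, map_add, hx, hy, LinearMap.add_apply]
  | tmul x a =>
    induction w with
    | zero => simp
    | add x y hx hy => simp only [TensorProduct.tmul_add, map_add, hx, hy]
    | tmul y b => rfl

/-- Inside A ⊗ (A ⊗ B⁺/R), the required map is the restriction of Δ ⊗ id, which is defined on all of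
A ⊗ B⁺/R. -/
theorem derivOf_isEquivariant : (derivOf R hB).IsEquivariant hB := by
  rw [Deriv.isEquivariant_iff]
  intro t ht
  have hinj : Function.Injective (((GammaIncl R hB).restrictScalars ℂ).lTensor A) :=
    Module.Flat.lTensor_preserves_injective_linearMap _ (GammaIncl_injective R hB)
  apply hinj
  have key (t : B ⊗[ℂ] B) : ((GammaIncl R hB).restrictScalars ℂ).lTensor A
      ((derivOf R hB).formLin.lTensor A (Deriv.diagCoact hB t)) =
      TensorProduct.assoc ℂ A A _ ((Coalgebra.comul (R := ℂ)).rTensor _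
        (GammaIncl R hB ((derivOf R hB).formLin t))) := by
    induction t with
    | zero => simp
    | add x y hx hy => simp only [map_add, hx, hy]
    | tmul a b =>
      rw [Deriv.lTensor_formLin_diagCoact_tmul, lTensor_GammaIncl_diagForm, lTensor_coactLin,
        GammaIncl_formLin_tmul, assoc_comul_mulLeft, lTensor_dLin]
  rw [key, ht]
  simp

theorem toRightIdeal_derivOf_le : (derivOf R hB).toRightIdeal.carrier ≤ R.carrier := by
  rintro _ ⟨t, ht, rfl⟩
  -- ε ⊗ id sends a b₁ ⊗ p(b₂⁺) to ε(a) p(b⁺).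
  have key (t : B ⊗[ℂ] B) : TensorProduct.lid ℂ _ ((Coalgebra.counit (R := ℂ)).rTensor _
      (GammaIncl R hB ((derivOf R hB).formLin t))) = R.carrier.mkQ (Deriv.counitPlus B t) := by
    induction t with
    | zero => simp
    | add x y hx hy => simp only [map_add, hx, hy]
    | tmul a b =>
      have h (z : A ⊗[ℂ] (Bplus B ⧸ R.carrier)) : (Coalgebra.counit (R := ℂ)).rTensor _
          ((LinearMap.mulLeft ℂ (a : A)).rTensor _ z) =
          counitB B a • (Coalgebra.counit (R := ℂ)).rTensor _ z := by
        induction z with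
        | zero => simp
        | add x y hx hy => simp only [map_add, smul_add, hx, hy]
        | tmul c v =>
          simp only [LinearMap.rTensor_tmul, LinearMap.mulLeft_apply, Bialgebra.counit_mul,
            TensorProduct.smul_tmul', smul_eq_mul]
          rfl
      rw [GammaIncl_formLin_tmul, h, dLin, LinearMap.comp_apply, ← LinearMap.comp_apply,
        LinearMap.rTensor_comp_lTensor, ← LinearMap.lTensor_comp_rTensor, LinearMap.comp_apply,
        counit_rTensor_coactLin, Deriv.counitPlus_tmul]
      simp
  have ht' : (derivOf R hB).formLin t = 0 := ht
  rw [← Submodule.Quotient.mk_eq_zero, ← Submodule.mkQ_apply, ← key, ht']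
  simp

variable {R} in
theorem RightIdeal.IsStable.map_mkQ_coactLin (hR : R.IsStable) (r : R.carrier) :
    TensorProduct.map (BplusA B).mkQ (R.carrier.mkQ ∘ₗ plus B)
      (coactLin hB ((r : Bplus B) : B)) = 0 := by
  obtain ⟨y, hy⟩ := hR r
  have hinj : Function.Injective (B.val.toLinearMap.lTensor (A ⧸ BplusA B)) :=
    Module.Flat.lTensor_preserves_injective_linearMap _ Subtype.val_injective
  -- Stability is stated in Ā ⊗ A; injectivity of Ā ⊗ B → Ā ⊗ A brings it back to Ā ⊗ B, where p ∘
  -- (·)⁺ can be applied.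
  have h : (BplusA B).mkQ.rTensor B (coactLin hB ((r : Bplus B) : B)) =
      ((Bplus B).subtype ∘ₗ R.carrier.subtype).lTensor _ y := by
    apply hinj
    rw [← LinearMap.comp_apply, LinearMap.lTensor_comp_rTensor, ← comulBar_val,
      ← LinearMap.comp_apply, ← LinearMap.lTensor_comp]
    exact hy.symm
  rw [← LinearMap.lTensor_comp_rTensor, LinearMap.comp_apply, h, ← LinearMap.comp_apply,
    ← LinearMap.lTensor_comp]
  have h0 : (R.carrier.mkQ ∘ₗ plus B) ∘ₗ (Bplus B).subtype ∘ₗ R.carrier.subtype = 0 := by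
    ext x
    simp [plus_coe]
  rw [h0]
  simp

/-- The map `a ⊗ v ↦ S(a₍₁₎) ⊗ (a₍₂₎ ⊗ v)` from `A ⊗ V` to `A ⊗_B (A ⊗ V)`. -/
def antipodeSplit (B : Subalgebra ℂ A) (V : Type u) [AddCommGroup V] [Module ℂ V] :
    A ⊗[ℂ] V →ₗ[ℂ] TensorB B (A ⊗[ℂ] V) :=
  mkB B (A ⊗[ℂ] V) ∘ₗ (HopfAlgebra.antipode ℂ).rTensor (A ⊗[ℂ] V) ∘ₗ
    (TensorProduct.assoc ℂ A A V).toLinearMap ∘ₗ (Coalgebra.comul (R := ℂ)).rTensor V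

/-- S(b₁a₁) ⊗ b₂a₂ ⊗ v = S(a₁) S(b₁) b₂ ⊗ a₂ ⊗ v over B, because b₂ ∈ B may cross the tensor sign;
then S(b₁) b₂ = ε(b). Hence the map kills B⁺A ⊗ V. -/
theorem antipodeSplit_mul_tmul (hB : IsLeftCoideal B) {V : Type u} [AddCommGroup V] [Module ℂ V]
    (b : B) (a : A) (v : V) :
    antipodeSplit B V (((b : A) * a) ⊗ₜ v) = counitB B b • antipodeSplit B V (a ⊗ₜ v) := by
  simp only [antipodeSplit, LinearMap.comp_apply, LinearEquiv.coe_coe,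
    LinearMap.rTensor_tmul, Bialgebra.comul_mul]
  rw [← lTensor_coactLin hB]
  have key (u : A ⊗[ℂ] B) (w : A ⊗[ℂ] A) :
      mkB B (A ⊗[ℂ] V) ((HopfAlgebra.antipode ℂ).rTensor (A ⊗[ℂ] V)
        (TensorProduct.assoc ℂ A A V ((B.val.toLinearMap.lTensor A u * w) ⊗ₜ v))) =
      mkB B (A ⊗[ℂ] V) ((LinearMap.mulRight ℂ (LinearMap.mul' ℂ A
        (TensorProduct.map (HopfAlgebra.antipode ℂ) B.val.toLinearMap u))).rTensor _
        ((HopfAlgebra.antipode ℂ).rTensor (A ⊗[ℂ] V)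
        (TensorProduct.assoc ℂ A A V (w ⊗ₜ v)))) := by
    induction w with
    | zero => simp
    | add x y hx hy => simp only [mul_add, TensorProduct.add_tmul, map_add, hx, hy]
    | tmul x y =>
      induction u with
      | zero => simp
      | add p q hp hq =>
        simp only [LinearMap.rTensor_tmul, TensorProduct.assoc_tmul, LinearMap.mulRight_apply]
          at hp hq ⊢
        simp only [map_add, add_mul, mul_add, TensorProduct.add_tmul, hp, hq]
      | tmul p c =>
        simp only [LinearMap.lTensor_tmul, Algebra.TensorProduct.tmul_mul_tmul,
          TensorProduct.assoc_tmul, LinearMap.rTensor_tmul, TensorProduct.map_tmul,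
          LinearMap.mul'_apply, LinearMap.mulRight_apply, HopfAlgebra.antipode_mul_antidistrib]
        exact (mkB_mul_tmul _ c (y ⊗ₜ[ℂ] v)).symm.trans (by rw [mul_assoc]; rfl)
  rw [key, mul_antipode_val_coactLin]
  have h : LinearMap.mulRight ℂ (algebraMap ℂ A (counitB B b)) =
      counitB B b • LinearMap.id := by
    ext x
    simp [Algebra.smul_def, Algebra.commutes]
  rw [h]
  simp only [LinearMap.rTensor_smul, LinearMap.smul_apply, LinearMap.rTensor_id,
    LinearMap.id_apply, map_smul]

theorem antipodeSplit_eq_zero (hB : IsLeftCoideal B) {V : Type u} [AddCommGroup V] [Module ℂ V]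
    (x : A ⊗[ℂ] V) (hx : (BplusA B).mkQ.rTensor V x = 0) : antipodeSplit B V x = 0 := by
  have hle : BplusA B ≤ LinearMap.ker (TensorProduct.curry (antipodeSplit B V)) := by
    apply Submodule.span_le.2
    rintro _ ⟨b, hb, a, rfl⟩
    ext v
    have hb' : counitB B b = 0 := hb
    simp [antipodeSplit_mul_tmul hB, hb']
  have h : TensorProduct.lift ((BplusA B).liftQ _ hle) ∘ₗ (BplusA B).mkQ.rTensor V =
      antipodeSplit B V := by
    ext a v
    rfl
  rw [← h, LinearMap.comp_apply, hx, map_zero]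

theorem antipodeSplit_dLin (b : B) : antipodeSplit B _ (dLin R hB b) =
    mkB B _ (TensorProduct.map (HopfAlgebra.antipode ℂ) (dLin R hB) (coactLin hB b)) := by
  rw [← LinearMap.rTensor_comp_lTensor, LinearMap.comp_apply, lTensor_dLin]
  rfl

variable {R} in
theorem RightIdeal.IsStable.le_toRightIdeal_derivOf (hR : R.IsStable)
    (hflat : IsFaithfullyFlatRight B) :
    R.carrier ≤ (derivOf R hB).toRightIdeal.carrier := by
  intro r hr
  let δ := derivOf R hB
  let dΓ : B →ₗ[ℂ] δ.Gamma := δ.formLin ∘ₗ TensorProduct.mk ℂ B B 1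
  -- x = S(r₁) ⊗ δ r₂, with the second factor kept in Γ(δ): the functional ψ below exists only
  -- there, so flatness is needed to see that x vanishes over B.
  let x : A ⊗[ℂ] δ.Gamma := TensorProduct.map (HopfAlgebra.antipode ℂ) dΓ (coactLin hB (r : B))
  have hx : mkB B δ.Gamma x = 0 := by
    apply hflat.tensorBMap_injective (GammaIncl_injective R hB)
    rw [tensorBMap_mkB, map_zero, ← LinearMap.comp_apply (LinearMap.lTensor A _),
      LinearMap.lTensor_comp_map]
    have hd : (GammaIncl R hB).restrictScalars ℂ ∘ₗ dΓ = dLin R hB := by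
      ext b
      change GammaIncl R hB (δ.formLin (1 ⊗ₜ b)) = _
      rw [GammaIncl_formLin_tmul]
      simp
    rw [hd, ← antipodeSplit_dLin]
    apply antipodeSplit_eq_zero hB
    rw [dLin, LinearMap.comp_apply, ← LinearMap.comp_apply, LinearMap.rTensor_comp_lTensor]
    exact hR.map_mkQ_coactLin hB ⟨r, hr⟩
  obtain ⟨ψ, hψ⟩ := exists_comp_eq_of_ker_le
    (g := δ.toRightIdeal.carrier.mkQ ∘ₗ Deriv.counitPlus B) δ.formLin_surjective
    (fun t ht => (Submodule.Quotient.mk_eq_zero _).2 ⟨t, ht, rfl⟩)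
  -- ε ⊗ ψ with ψ(a δ b) = ε(a) b⁺ mod R_δ. It is B-balanced as both factors turn b ∈ B into ε(b).
  -- Since ε ∘ S = ε, its value at x is ψ(δ r), the class of r.
  let f : A ⊗[ℂ] δ.Gamma →ₗ[ℂ] Bplus B ⧸ δ.toRightIdeal.carrier :=
    (TensorProduct.lid ℂ _).toLinearMap ∘ₗ TensorProduct.map (Coalgebra.counit (R := ℂ)) ψ
  have hf : balanced B δ.Gamma ≤ LinearMap.ker f := by
    apply Submodule.span_le.2
    rintro _ ⟨a, b, γ, rfl⟩
    obtain ⟨t, rfl⟩ := δ.formLin_surjective γ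
    have h : ψ (b • δ.formLin t) = counitB B b • ψ (δ.formLin t) := by
      rw [δ.smul_formLin, hψ, hψ, LinearMap.comp_apply, Deriv.counitPlus_mulLeft, map_smul]
      rfl
    change f _ = 0
    have h' : Coalgebra.counit (R := ℂ) (b : A) = counitB B b := rfl
    simp [f, h, h', Bialgebra.counit_mul, mul_smul, smul_comm (counitB B b)]
  have hfx : f x = 0 := hf ((Submodule.Quotient.mk_eq_zero _).1 hx)
  have hfr : f x = δ.toRightIdeal.carrier.mkQ r := by
    change TensorProduct.lid ℂ _ (TensorProduct.map (Coalgebra.counit (R := ℂ)) ψ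
      (TensorProduct.map (HopfAlgebra.antipode ℂ) dΓ (coactLin hB (r : B)))) = _
    rw [← LinearMap.comp_apply (TensorProduct.map _ _), ← TensorProduct.map_comp,
      HopfAlgebra.counit_comp_antipode, ← LinearMap.lTensor_comp_rTensor, LinearMap.comp_apply,
      counit_rTensor_coactLin, LinearMap.lTensor_tmul, TensorProduct.lid_tmul, one_smul]
    change ψ (δ.formLin (1 ⊗ₜ (r : B))) = _
    rw [hψ, LinearMap.comp_apply, counitPlus_one_tmul]
  exact (Submodule.Quotient.mk_eq_zero _).1 (hfr.symm.trans hfx)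

variable {R} in
theorem RightIdeal.IsStable.toRightIdeal_derivOf (hR : R.IsStable)
    (hflat : IsFaithfullyFlatRight B) : (derivOf R hB).toRightIdeal = R :=
  RightIdeal.ext (le_antisymm (toRightIdeal_derivOf_le R hB)
    (hR.le_toRightIdeal_derivOf hB hflat))

/-! ### Recovering an equivariant δ from R_δ. -/

namespace Deriv

variable {hB} {δ : Deriv B}

theorem IsEquivariant.derivOf_toRightIdeal_le (h : δ.IsEquivariant hB) :
    derivOf δ.toRightIdeal hB ≤ δ := by
  rw [le_iff]
  intro t ht
  obtain ⟨y, hy⟩ := h.diagCoact_mem ht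
  rw [formLin_derivOf_eq_zero_iff, GammaIncl_formLin, ← hy, ← LinearMap.comp_apply,
    ← LinearMap.lTensor_comp]
  have h0 : δ.toRightIdeal.carrier.mkQ ∘ₗ δ.toRightIdeal.carrier.subtype = 0 := by
    ext x
    simp
  rw [h0]
  simp

variable (δ hB) in
/-- The map `b ↦ S(b₍₁₎) ⊗ δ b₍₂₎` from `B` to `A ⊗ M`. -/
def antipodeD : B →ₗ[ℂ] A ⊗[ℂ] δ.M :=
  TensorProduct.map (HopfAlgebra.antipode ℂ) δ.d ∘ₗ coactLin hB

theorem antipodeD_plus (b : B) : antipodeD hB δ (plus B b : B) = antipodeD hB δ b := by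
  have h : antipodeD hB δ 1 = 0 := by
    rw [antipodeD, LinearMap.comp_apply, coactLin_one, Algebra.TensorProduct.one_def,
      TensorProduct.map_tmul, d_one, TensorProduct.tmul_zero]
  rw [coe_plus, map_sub, map_smul, h, smul_zero, sub_zero]

theorem mkB_antipode_diagForm (a : A) (u w : A ⊗[ℂ] B) :
    mkB B δ.M (TensorProduct.map (LinearMap.mulLeft ℂ a ∘ₗ HopfAlgebra.antipode ℂ)
      δ.Gamma.subtype (δ.diagForm (u ⊗ₜ w))) =
    mkB B δ.M ((LinearMap.mulLeft ℂ a ∘ₗ LinearMap.mulRight ℂ (LinearMap.mul' ℂ A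
      (TensorProduct.map (HopfAlgebra.antipode ℂ) B.val.toLinearMap u))).rTensor _
      (TensorProduct.map (HopfAlgebra.antipode ℂ) δ.d w)) := by
  induction w with
  | zero => simp
  | add x y hx hy => simp only [TensorProduct.tmul_add, map_add, hx, hy]
  | tmul y b =>
    induction u with
    | zero => simp
    | add p q hp hq =>
      simp only [TensorProduct.map_tmul, LinearMap.rTensor_tmul, LinearMap.comp_apply,
        LinearMap.mulRight_apply, LinearMap.mulLeft_apply] at hp hq ⊢
      simp only [TensorProduct.add_tmul, map_add, mul_add, hp, hq]
    | tmul x c =>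
      simp only [diagForm_tmul, TensorProduct.map_tmul, LinearMap.rTensor_tmul,
        LinearMap.comp_apply, LinearMap.mulRight_apply, LinearMap.mulLeft_apply,
        LinearMap.mul'_apply, HopfAlgebra.antipode_mul_antidistrib]
      exact (mkB_mul_tmul _ c (δ.d b)).symm.trans (by simp only [mul_assoc]; rfl)

/-- Over B, a S(c₁b₁) ⊗ c₂ δ b₂ = a S(b₁) S(c₁) c₂ ⊗ δ b₂ = ε(c) a S(b₁) ⊗ δ b₂. With equivariance,
this makes the last expression vanish on R_δ. -/
theorem mkB_antipode_diagCoact (a : A) (t : B ⊗[ℂ] B) :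
    mkB B δ.M (TensorProduct.map (LinearMap.mulLeft ℂ a ∘ₗ HopfAlgebra.antipode ℂ)
      δ.Gamma.subtype (δ.formLin.lTensor A (diagCoact hB t))) =
    mkB B δ.M ((LinearMap.mulLeft ℂ a).rTensor _
      (antipodeD hB δ (counitPlus B t : B))) := by
  induction t with
  | zero => simp
  | add x y hx hy => simp only [map_add, hx, hy, Submodule.coe_add]
  | tmul c b =>
    rw [lTensor_formLin_diagCoact_tmul, mkB_antipode_diagForm, mul_antipode_val_coactLin,
      counitPlus_tmul, Submodule.coe_smul, map_smul, antipodeD_plus, map_smul]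
    have h : LinearMap.mulLeft ℂ a ∘ₗ LinearMap.mulRight ℂ (algebraMap ℂ A (counitB B c)) =
        counitB B c • LinearMap.mulLeft ℂ a := by
      ext x
      simp [Algebra.smul_def, Algebra.commutes]
    rw [h, LinearMap.rTensor_smul]
    rfl

theorem IsEquivariant.mkB_antipodeD_eq_zero (h : δ.IsEquivariant hB) (a : A) {r : Bplus B}
    (hr : r ∈ δ.toRightIdeal.carrier) :
    mkB B δ.M ((LinearMap.mulLeft ℂ a).rTensor _ (antipodeD hB δ (r : B))) = 0 := by
  obtain ⟨t, ht, rfl⟩ := hr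
  rw [← mkB_antipode_diagCoact, isEquivariant_iff.1 h t ht]
  simp

/-- The map `A ⊗ (B⁺ / R_δ) → A ⊗_B M`, `a ⊗ p(b) ↦ a S(b₍₁₎) ⊗ δ b₍₂₎`. -/
def IsEquivariant.recover (h : δ.IsEquivariant hB) :
    A ⊗[ℂ] (Bplus B ⧸ δ.toRightIdeal.carrier) →ₗ[ℂ] TensorB B δ.M :=
  TensorProduct.lift (LinearMap.flip (δ.toRightIdeal.carrier.liftQ
    (LinearMap.flip (TensorProduct.curry (mkB B δ.M ∘ₗ
      TensorProduct.lift (LinearMap.rTensorHom δ.M ∘ₗ LinearMap.mul ℂ A) ∘ₗ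
      (antipodeD hB δ ∘ₗ (Bplus B).subtype).lTensor A)))
    (fun _ hr => LinearMap.ext fun a => h.mkB_antipodeD_eq_zero a hr)))

theorem IsEquivariant.recover_tmul (h : δ.IsEquivariant hB) (a : A) (b : B) :
    h.recover (a ⊗ₜ δ.toRightIdeal.carrier.mkQ (plus B b)) =
      mkB B δ.M ((LinearMap.mulLeft ℂ a).rTensor _ (antipodeD hB δ b)) := by
  rw [← antipodeD_plus]
  rfl

/-- By coassociativity the image is a b₁ S(b₂) ⊗ δ b₃, and b₁ S(b₂) collapses to the counit. -/
theorem IsEquivariant.recover_dLin (h : δ.IsEquivariant hB) (a : A) (b : B) :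
    h.recover ((LinearMap.mulLeft ℂ a).rTensor _ (dLin δ.toRightIdeal hB b)) =
      mkB B δ.M (a ⊗ₜ δ.d b) := by
  let F : A ⊗[ℂ] (A ⊗[ℂ] B) →ₗ[ℂ] A ⊗[ℂ] δ.M :=
    TensorProduct.lift (LinearMap.rTensorHom δ.M ∘ₗ LinearMap.mul ℂ A) ∘ₗ
      (TensorProduct.map (HopfAlgebra.antipode ℂ) δ.d).lTensor A
  have h₁ (w : A ⊗[ℂ] B) : h.recover ((LinearMap.mulLeft ℂ a).rTensor _
      ((δ.toRightIdeal.carrier.mkQ ∘ₗ plus B).lTensor A w)) =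
      mkB B δ.M ((LinearMap.mulLeft ℂ a).rTensor _ (F ((coactLin hB).lTensor A w))) := by
    induction w with
    | zero => simp
    | add x y hx hy => simp only [map_add, hx, hy]
    | tmul x c =>
      change h.recover ((a * x) ⊗ₜ δ.toRightIdeal.carrier.mkQ (plus B c)) = _
      rw [h.recover_tmul, LinearMap.mulLeft_mul, LinearMap.rTensor_comp]
      rfl
  have h₂ (s : (A ⊗[ℂ] A) ⊗[ℂ] B) : F (TensorProduct.assoc ℂ A A B s) =
      TensorProduct.map (LinearMap.mul' ℂ A ∘ₗ (HopfAlgebra.antipode ℂ).lTensor A) δ.d s := by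
    have : F ∘ₗ (TensorProduct.assoc ℂ A A B).toLinearMap =
        TensorProduct.map (LinearMap.mul' ℂ A ∘ₗ (HopfAlgebra.antipode ℂ).lTensor A) δ.d := by
      ext x y c
      rfl
    exact LinearMap.congr_fun this s
  have h₃ : (LinearMap.mul' ℂ A ∘ₗ (HopfAlgebra.antipode ℂ).lTensor A) ∘ₗ
      Coalgebra.comul = Algebra.linearMap ℂ A ∘ₗ Coalgebra.counit :=
    HopfAlgebra.mul_antipode_lTensor_comul
  rw [dLin, LinearMap.comp_apply, h₁, ← coactLin_coassoc, h₂,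
    ← LinearMap.comp_apply (TensorProduct.map _ _), LinearMap.map_comp_rTensor, h₃,
    ← LinearMap.map_comp_rTensor, LinearMap.comp_apply, counit_rTensor_coactLin]
  simp

theorem IsEquivariant.le_derivOf_toRightIdeal (h : δ.IsEquivariant hB)
    (hflat : IsFaithfullyFlatRight B) : δ ≤ derivOf δ.toRightIdeal hB := by
  rw [le_iff]
  intro t ht
  apply Subtype.ext
  -- Faithfulness is applied in M itself, the target of `recover`, rather than in Γ(δ).
  refine hflat.eq_zero_of_mkB_eq_zero (m := (δ.formLin t : δ.M)) fun a => ?_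
  have key (t : B ⊗[ℂ] B) : mkB B δ.M (a ⊗ₜ (δ.formLin t : δ.M)) =
      h.recover ((LinearMap.mulLeft ℂ a).rTensor _
        (GammaIncl _ hB ((derivOf δ.toRightIdeal hB).formLin t))) := by
    induction t with
    | zero => simp
    | add x y hx hy => simp only [map_add, Submodule.coe_add, TensorProduct.tmul_add, hx, hy]
    | tmul c b =>
      rw [GammaIncl_formLin_tmul, ← LinearMap.comp_apply (LinearMap.rTensor _ _),
        ← LinearMap.rTensor_comp, ← LinearMap.mulLeft_mul, h.recover_dLin, mkB_mul_tmul]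
      rfl
  rw [key, ht]
  simp

end Deriv

end Bijection

end QHS

end

theorem theorem2 {A : Type u} [Ring A] [HopfAlgebra ℂ A] (B : Subalgebra ℂ A)
    (hB : QHS.IsLeftCoideal B) (hflat : QHS.IsFaithfullyFlatRight B) :
    Set.BijOn (QHS.RightIdeal.toDeriv hB)
        {R : QHS.RightIdeal B | R.IsStable} {δ : QHS.DerivClass B | δ.IsEquivariant hB} ∧
      Set.BijOn QHS.DerivClass.toRightIdeal
        {δ : QHS.DerivClass B | δ.IsEquivariant hB} {R : QHS.RightIdeal B | R.IsStable} ∧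
      Set.InvOn QHS.DerivClass.toRightIdeal (QHS.RightIdeal.toDeriv hB)
        {R : QHS.RightIdeal B | R.IsStable} {δ : QHS.DerivClass B | δ.IsEquivariant hB} := by
  have hinv : Set.InvOn QHS.DerivClass.toRightIdeal (QHS.RightIdeal.toDeriv hB)
      {R : QHS.RightIdeal B | R.IsStable} {δ : QHS.DerivClass B | δ.IsEquivariant hB} := by
    refine ⟨fun R hR => QHS.RightIdeal.IsStable.toRightIdeal_derivOf hB hR hflat, fun δ hδ => ?_⟩
    induction δ using Quotient.inductionOn with
    | h δ =>
      have hδ' : δ.IsEquivariant hB := hδ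
      exact Quotient.sound ⟨hδ'.derivOf_toRightIdeal_le, hδ'.le_derivOf_toRightIdeal hflat⟩
  have h₁ : Set.MapsTo (QHS.RightIdeal.toDeriv hB) {R : QHS.RightIdeal B | R.IsStable}
      {δ : QHS.DerivClass B | δ.IsEquivariant hB} :=
    fun R _ => QHS.derivOf_isEquivariant R hB
  have h₂ : Set.MapsTo QHS.DerivClass.toRightIdeal
      {δ : QHS.DerivClass B | δ.IsEquivariant hB} {R : QHS.RightIdeal B | R.IsStable} := by
    intro δ hδ
    induction δ using Quotient.inductionOn with
    | h δ => exact QHS.Deriv.IsEquivariant.isStable_toRightIdeal hδ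
  exact ⟨hinv.bijOn h₁ h₂, hinv.symm.bijOn h₂ h₁, hinv⟩
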